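/- Let $k$ be a field of prime characteristic $p$, let $r\ge 0$, and let $$R=\frac{k[t,x,y]}{(f_1,\ldots,f_r)},$$ where $f_1,\ldots,f_r$ are homogeneous polynomials with respect to the grading in which $\deg t=0$ and $\deg x=\deg y=1$. For an ideal $J$ of $R$ and $q=p^e$ let $J^{[q]}$ denote the ideal generated by the $q$th powers of the elements (equivalently, of a set of generators) of $J$, and write $J^{c[q]}=(J^c)^{[q]}$. Let $I=(x,y)\subseteq R$. Then the Frobenius powers of $I$ have linear growth of primary decompositions: there is a number $c\in\mathbb{N}$ such that for each $q=p^e$, $e\ge 0$, there is a primary decomposition $$I^{[q]}=Q_1\cap Q_2\cap\cdots\cap Q_m$$ (with $m$ depending on $q$, and $m=0$ allowed when $I^{[q]}=R$) such that $(\sqrt{Q_i})^{c[q]}\subseteq Q_i$ for all $i=1,\ldots,m$. -/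

import Mathlib

/-- The `q`-th Frobenius power `I^{[q]}` of an ideal `I`: the ideal generated by the `q`-th powers
of the elements of `I`. In characteristic `p` and for `q = p ^ e` it is generated by the `q`-th
powers of any set of generators of `I`, see `frobeniusPower_span`. -/
def frobeniusPower {R : Type*} [CommRing R] (I : Ideal R) (q : ℕ) : Ideal R :=
  Ideal.span ((fun a : R => a ^ q) '' (I : Set R))

theorem frobeniusPower_span {R : Type*} [CommRing R] (p : ℕ) [ExpChar R p] (S : Set R) (e : ℕ) :
    frobeniusPower (Ideal.span S) (p ^ e) = Ideal.span ((fun a : R => a ^ (p ^ e)) '' S) :=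
  Ideal.map_span (iterateFrobenius R p e) S

/-- The Frobenius powers `I^{[p ^ e]}` of `I` have linear growth of primary decompositions:
there is a constant `c` such that every `I^{[q]}`, `q = p ^ e`, is the intersection of a finite set
of primary ideals `Q`, each of which contains `((√Q)^c)^{[q]}`. (The unit ideal is the empty
intersection.) -/
def HasLinearGrowthOfPrimaryDecompositions {R : Type*} [CommRing R] (p : ℕ) (I : Ideal R) : Prop :=
  ∃ c : ℕ, ∀ e : ℕ, ∃ s : Finset (Ideal R),
    s.inf id = frobeniusPower I (p ^ e) ∧
      ∀ Q ∈ s, Q.IsPrimary ∧ frobeniusPower (Q.radical ^ c) (p ^ e) ≤ Q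

/-!
Let `A = k[t]`, let `q = p ^ e`, `J = I^{[q]}`, and let `T` be the ideal of the elements of `R` that
are `A`-torsion modulo `J`. Since `R ⧸ I` is a quotient of `A` and `I` is nilpotent modulo `J`, the
ideal `T` is primary or the unit ideal. If a nonzero `δ` in `A` kills `T / J`, then
`J = T ⊓ (J + δ R)`. A primary ideal `Q` containing `J + δ R` has `√Q ⊆ I + (π)` for a prime `π` of
`A` dividing `δ`, and it contains `π ^ n` for the largest `n` with `π ^ n ∣ δ`. Hence linear growth
follows as soon as these exponents `n` are bounded linearly in `q`.

To find `δ`, note that the part of `R ⧸ J` of degree `d` is the cokernel of a matrix over `A` with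
at most `q` rows, one for each monomial `x ^ i * y ^ j` of degree `d` with `i, j < q`, and with
entries of degree in `t` at most a constant `D`. By Cramer's rule its torsion is killed by a nonzero
minor `δ_d` of degree at most `q * D`. The least common multiple of the finitely many `δ_d` may have
a large degree, but a power `π ^ n` dividing it divides one of the `δ_d`, so that `n ≤ q * D`.
-/

section PrincipalIdealDomain

theorem le_radical_frobeniusPower {R : Type*} [CommRing R] (I : Ideal R) (q : ℕ) :
    I ≤ (frobeniusPower I q).radical :=
  fun z hz => ⟨q, Ideal.subset_span ⟨z, hz, rfl⟩⟩

theorem frobeniusPower_eq_map {R : Type*} [CommRing R] (p : ℕ) [ExpChar R p] (I : Ideal R)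
    (e : ℕ) : frobeniusPower I (p ^ e) = I.map (iterateFrobenius R p e) :=
  rfl

theorem sup_pow_le_sup_pow {R : Type*} [CommSemiring R] (I J : Ideal R) (n : ℕ) :
    (I ⊔ J) ^ n ≤ I ⊔ J ^ n := by
  induction n with
  | zero => simp
  | succ n ih =>
    calc (I ⊔ J) ^ (n + 1) ≤ (I ⊔ J ^ n) * (I ⊔ J) := by
          rw [pow_succ]; exact Ideal.mul_mono_left ih
      _ = I * (I ⊔ J) ⊔ (J ^ n * I ⊔ J ^ (n + 1)) := by
          rw [Ideal.sup_mul, Ideal.mul_sup (J ^ n), ← pow_succ]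
      _ ≤ I ⊔ J ^ (n + 1) :=
          sup_le (le_sup_of_le_left Ideal.mul_le_left)
            (sup_le_sup_right Ideal.mul_le_right _)

open scoped nonZeroDivisors

variable {A R : Type*} [CommRing A] [CommRing R] [Algebra A R]

variable (A) in
/-- The ideal of the elements of `R` whose class in `R ⧸ J` is `A`-torsion. -/
def torsionClosure (J : Ideal R) : Ideal R :=
  (Submodule.torsion' R (R ⧸ J) A⁰).comap J.mkQ

theorem mem_torsionClosure {J : Ideal R} {z : R} :
    z ∈ torsionClosure A J ↔ ∃ a ∈ A⁰, a • z ∈ J := by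
  simp only [torsionClosure, Submodule.mem_comap, Submodule.mem_torsion'_iff, Subtype.exists,
    Submonoid.mk_smul, exists_prop, ← Submodule.Quotient.mk_eq_zero J, Submodule.Quotient.mk_smul,
    Submodule.mkQ_apply]

theorem le_torsionClosure (J : Ideal R) : J ≤ torsionClosure A J :=
  fun _ hz => mem_torsionClosure.mpr ⟨1, one_mem _, by rwa [one_smul]⟩

theorem mem_torsionClosure_of_smul_mem {J : Ideal R} {a : A} (ha : a ∈ A⁰) {z : R}
    (h : a • z ∈ torsionClosure A J) : z ∈ torsionClosure A J := by
  obtain ⟨b, hb, hz⟩ := mem_torsionClosure.mp h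
  exact mem_torsionClosure.mpr ⟨b * a, mul_mem hb ha, by rwa [mul_smul]⟩

theorem exists_sub_algebraMap_mem {I : Ideal R} (hI : Function.Surjective (algebraMap A (R ⧸ I)))
    (z : R) : ∃ a : A, z - algebraMap A R a ∈ I := by
  obtain ⟨a, ha⟩ := hI (Ideal.Quotient.mk I z)
  exact ⟨a, Ideal.Quotient.eq.mp ha.symm⟩

theorem le_sup_map_comap {I K : Ideal R} (hI : Function.Surjective (algebraMap A (R ⧸ I)))
    (hIK : I ≤ K) : K ≤ I ⊔ (K.comap (algebraMap A R)).map (algebraMap A R) := by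
  intro z hz
  obtain ⟨a, ha⟩ := exists_sub_algebraMap_mem hI z
  have haK : algebraMap A R a ∈ K := (Submodule.sub_mem_iff_right _ hz).mp (hIK ha)
  exact (sub_add_cancel z (algebraMap A R a)) ▸
    Submodule.add_mem_sup ha (Ideal.mem_map_of_mem _ haK)

theorem isPrimary_of_forall_mem_of_smul_mem [NoZeroDivisors A] {I Q : Ideal R}
    (hI : Function.Surjective (algebraMap A (R ⧸ I))) (hIQ : I ≤ Q.radical) (hQ : Q ≠ ⊤)
    (hreg : ∀ a : A, a ≠ 0 → ∀ z : R, a • z ∈ Q → z ∈ Q) : Q.IsPrimary := by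
  refine Ideal.isPrimary_iff.mpr ⟨hQ, fun {u v} huv => ?_⟩
  obtain ⟨a, ha⟩ := exists_sub_algebraMap_mem hI v
  rcases eq_or_ne a 0 with rfl | ha0
  · exact .inr (hIQ (by simpa using ha))
  -- Both `v` and `v - a` lie in the radical of the colon ideal `(Q : u)`, hence so does `a`.
  let K : Ideal R := Submodule.comap (LinearMap.mulLeft R u) Q
  have hQK : Q ≤ K := fun z hz => Q.mul_mem_left u hz
  have hvK : v ∈ K.radical := Ideal.le_radical huv
  obtain ⟨n, hn⟩ : algebraMap A R a ∈ K.radical :=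
    (Submodule.sub_mem_iff_right _ hvK).mp (Ideal.radical_mono hQK (hIQ ha))
  refine .inl (hreg (a ^ n) (pow_ne_zero n ha0) u ?_)
  rw [Algebra.smul_def, map_pow, mul_comm]
  exact hn

theorem isPrimary_torsionClosure [NoZeroDivisors A] {I J : Ideal R}
    (hI : Function.Surjective (algebraMap A (R ⧸ I))) (hIJ : I ≤ J.radical)
    (hJ : torsionClosure A J ≠ ⊤) : (torsionClosure A J).IsPrimary :=
  isPrimary_of_forall_mem_of_smul_mem hI (hIJ.trans (Ideal.radical_mono (le_torsionClosure J))) hJ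
    fun _ ha _ hz => mem_torsionClosure_of_smul_mem (mem_nonZeroDivisors_of_ne_zero ha) hz

theorem comap_radical_torsionClosure [NoZeroDivisors A] {J : Ideal R}
    (hJ : torsionClosure A J ≠ ⊤) :
    (torsionClosure A J).radical.comap (algebraMap A R) = ⊥ := by
  refine eq_bot_iff.mpr fun a ⟨n, hn⟩ => ?_
  by_contra ha
  refine hJ ((Ideal.eq_top_iff_one _).mpr (mem_torsionClosure_of_smul_mem (a := a ^ n)
    (mem_nonZeroDivisors_of_ne_zero (pow_ne_zero n ha)) ?_))
  rwa [Algebra.smul_def, mul_one, map_pow]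

theorem eq_torsionClosure_inf_sup_span {J : Ideal R} {δ : A} (hδ : δ ∈ A⁰)
    (hJ : ∀ z ∈ torsionClosure A J, δ • z ∈ J) :
    J = torsionClosure A J ⊓ (J ⊔ Ideal.span {algebraMap A R δ}) := by
  refine le_antisymm (le_inf (le_torsionClosure J) le_sup_left) fun z hz => ?_
  obtain ⟨hzT, hz⟩ := hz
  obtain ⟨j, hj, y, hy, rfl⟩ := Submodule.mem_sup.mp hz
  obtain ⟨c, rfl⟩ := Ideal.mem_span_singleton.mp hy
  have hc : δ • c ∈ torsionClosure A J := by
    rw [Algebra.smul_def]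
    exact (Ideal.add_mem_iff_right _ (le_torsionClosure J hj)).mp hzT
  rw [← Algebra.smul_def]
  exact add_mem hj (hJ c (mem_torsionClosure_of_smul_mem hδ hc))

theorem frobeniusPower_radical_pow_le (p : ℕ) [ExpChar R p] {I Q : Ideal R}
    (hI : Function.Surjective (algebraMap A (R ⧸ I))) {e c : ℕ} {π : A}
    (hIQ : frobeniusPower I (p ^ e) ≤ Q)
    (hπ : Q.radical.comap (algebraMap A R) = Ideal.span {π})
    (hπQ : algebraMap A R (π ^ (p ^ e * c)) ∈ Q) :
    frobeniusPower (Q.radical ^ c) (p ^ e) ≤ Q := by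
  have hIr : I ≤ Q.radical :=
    (le_radical_frobeniusPower I (p ^ e)).trans (Ideal.radical_mono hIQ)
  have hrad : Q.radical ≤ I ⊔ Ideal.span {algebraMap A R π} := by
    simpa only [hπ, Ideal.map_span, Set.image_singleton] using le_sup_map_comap hI hIr
  calc frobeniusPower (Q.radical ^ c) (p ^ e)
      ≤ frobeniusPower ((I ⊔ Ideal.span {algebraMap A R π}) ^ c) (p ^ e) := by
        simp only [frobeniusPower_eq_map]
        exact Ideal.map_mono (Ideal.pow_right_mono hrad c)
    _ = (frobeniusPower I (p ^ e) ⊔ Ideal.span {algebraMap A R π ^ p ^ e}) ^ c := by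
        simp only [frobeniusPower_eq_map, Ideal.map_pow, Ideal.map_sup, Ideal.map_span,
          Set.image_singleton, iterateFrobenius_def]
    _ ≤ frobeniusPower I (p ^ e) ⊔ Ideal.span {algebraMap A R π ^ p ^ e} ^ c :=
        sup_pow_le_sup_pow _ _ _
    _ ≤ Q := by
        rw [Ideal.span_singleton_pow, ← pow_mul, ← map_pow]
        exact sup_le hIQ ((Ideal.span_singleton_le_iff_mem Q).mpr hπQ)

variable [IsDomain A] [IsPrincipalIdealRing A]

theorem exists_prime_pow_mem {Q : Ideal R} (hQ : Q.IsPrimary) {δ : A} (hδ : δ ≠ 0)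
    (hδQ : algebraMap A R δ ∈ Q) :
    ∃ (π : A) (n : ℕ), Prime π ∧ π ^ n ∣ δ ∧
      Q.radical.comap (algebraMap A R) = Ideal.span {π} ∧ algebraMap A R (π ^ n) ∈ Q := by
  let P : Ideal A := Q.radical.comap (algebraMap A R)
  have := Ideal.isPrime_radical hQ
  have hP : P ≠ ⊥ := Submodule.ne_bot_iff _ |>.mpr ⟨δ, Ideal.le_radical hδQ, hδ⟩
  have hπ := Submodule.IsPrincipal.prime_generator_of_isPrime P hP
  obtain ⟨n, h, hh, hδh⟩ := WfDvdMonoid.max_power_factor hδ hπ.irreducible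
  refine ⟨_, n, hπ, ⟨h, hδh⟩, (Ideal.span_singleton_generator P).symm, ?_⟩
  have hhP : algebraMap A R h ∉ Q.radical := fun hmem =>
    hh ((Submodule.IsPrincipal.mem_iff_generator_dvd P).mp hmem)
  rw [hδh, map_mul] at hδQ
  exact ((Ideal.isPrimary_iff.mp hQ).2 hδQ).resolve_right hhP

theorem frobeniusPower_radical_pow_le_of_isPrimary (p : ℕ) [ExpChar R p] {I Q : Ideal R}
    (hI : Function.Surjective (algebraMap A (R ⧸ I))) (hQ : Q.IsPrimary) {e c : ℕ}
    (hIQ : frobeniusPower I (p ^ e) ≤ Q) {δ : A} (hδ : δ ≠ 0) (hδQ : algebraMap A R δ ∈ Q)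
    (hδc : ∀ π n, Prime π → π ^ n ∣ δ → n ≤ p ^ e * c) :
    frobeniusPower (Q.radical ^ c) (p ^ e) ≤ Q := by
  obtain ⟨π, n, hπ, hπδ, hπQ, hn⟩ := exists_prime_pow_mem hQ hδ hδQ
  exact frobeniusPower_radical_pow_le p hI hIQ hπQ
    (Ideal.mem_of_dvd Q (map_dvd _ (pow_dvd_pow π (hδc π n hπ hπδ))) hn)

theorem hasLinearGrowthOfPrimaryDecompositions_of_torsion [IsNoetherianRing R] (p : ℕ)
    [ExpChar R p] {I : Ideal R} (hI : Function.Surjective (algebraMap A (R ⧸ I))) (c : ℕ)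
    (hT : ∀ e, ∃ δ : A, δ ≠ 0 ∧ (∀ π n, Prime π → π ^ n ∣ δ → n ≤ p ^ e * c) ∧
      ∀ z ∈ torsionClosure A (frobeniusPower I (p ^ e)), δ • z ∈ frobeniusPower I (p ^ e)) :
    HasLinearGrowthOfPrimaryDecompositions p I := by
  classical
  refine ⟨c + 1, fun e => ?_⟩
  obtain ⟨δ, hδ, hδc, hδT⟩ := hT e
  set J := frobeniusPower I (p ^ e)
  let T := torsionClosure A J
  have hJ : T ⊓ (J ⊔ Ideal.span {algebraMap A R δ}) = J :=
    (eq_torsionClosure_inf_sup_span (mem_nonZeroDivisors_of_ne_zero hδ) hδT).symm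
  obtain ⟨s, hs, hsPrimary⟩ : ∃ s : Finset (Ideal R),
      s.inf id = J ⊔ Ideal.span {algebraMap A R δ} ∧ ∀ ⦃Q⦄, Q ∈ s → Q.IsPrimary :=
    Submodule.isLasker R R _
  have hsGrowth : ∀ Q ∈ s, Q.IsPrimary ∧ frobeniusPower (Q.radical ^ (c + 1)) (p ^ e) ≤ Q := by
    intro Q hQ
    have hJQ : J ⊔ Ideal.span {algebraMap A R δ} ≤ Q := hs ▸ Finset.inf_le hQ
    have hδQ : algebraMap A R δ ∈ Q :=
      hJQ (Ideal.mem_sup_right (Ideal.mem_span_singleton_self _))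
    exact ⟨hsPrimary hQ, frobeniusPower_radical_pow_le_of_isPrimary p hI (hsPrimary hQ)
      (le_sup_left.trans hJQ) hδ hδQ
      fun π n hπ hπδ => (hδc π n hπ hπδ).trans (Nat.mul_le_mul_left _ c.le_succ)⟩
  by_cases hTtop : T = ⊤
  · rw [hTtop, top_inf_eq] at hJ
    exact ⟨s, hs.trans hJ, hsGrowth⟩
  have hTGrowth : frobeniusPower (T.radical ^ (c + 1)) (p ^ e) ≤ T := by
    refine frobeniusPower_radical_pow_le (π := (0 : A)) p hI (le_torsionClosure J) ?_ ?_
    · rw [Ideal.span_singleton_eq_bot.mpr rfl, comap_radical_torsionClosure hTtop]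
    · have hpe : p ^ e ≠ 0 := pow_ne_zero e (expChar_pos R p).ne'
      rw [zero_pow (mul_ne_zero hpe c.succ_ne_zero), map_zero]
      exact zero_mem T
  refine ⟨insert T s, by rw [Finset.inf_insert, hs, id, hJ],
    (Finset.forall_mem_insert _ _ _).mpr ⟨⟨?_, hTGrowth⟩, hsGrowth⟩⟩
  exact isPrimary_torsionClosure hI (le_radical_frobeniusPower I _) hTtop

end PrincipalIdealDomain

section Lcm

variable {α : Type*} [CommMonoidWithZero α] [NormalizedGCDMonoid α]
  [WfDvdMonoid α] {g : α} {n : ℕ}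

theorem pow_dvd_or_pow_dvd_of_pow_dvd_lcm (hg : Prime g) {a b : α} (ha : a ≠ 0) (hb : b ≠ 0)
    (h : g ^ n ∣ lcm a b) : g ^ n ∣ a ∨ g ^ n ∣ b := by
  wlog hab : multiplicity g a ≤ multiplicity g b generalizing a b
  · exact (this hb ha (h.trans (lcm_comm a b).dvd) (le_of_not_ge hab)).symm
  obtain ⟨a', ha', hga'⟩ :=
    (FiniteMultiplicity.of_not_isUnit hg.not_isUnit ha).exists_eq_pow_mul_and_not_dvd
  have hab' : a ∣ a' * b := by
    rw [ha', mul_comm]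
    exact mul_dvd_mul_left a' (pow_dvd_of_le_multiplicity hab)
  exact .inr (hg.pow_dvd_of_dvd_mul_left n hga' (h.trans (lcm_dvd hab' (dvd_mul_left b a'))))

theorem exists_pow_dvd_of_pow_dvd_finset_lcm (hg : Prime g) (hn : n ≠ 0) {ι : Type*}
    {s : Finset ι} {f : ι → α} (hf : ∀ i ∈ s, f i ≠ 0) (h : g ^ n ∣ s.lcm f) :
    ∃ i ∈ s, g ^ n ∣ f i := by
  classical
  have : Nontrivial α := ⟨g, 0, hg.ne_zero⟩
  induction s using Finset.induction_on with
  | empty => exact absurd (isUnit_of_dvd_one ((dvd_pow_self g hn).trans h)) hg.not_isUnit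
  | insert i s _ ih =>
    obtain ⟨hi, hs⟩ := (Finset.forall_mem_insert _ _ _).mp hf
    rw [Finset.lcm_insert] at h
    have hs0 : s.lcm f ≠ 0 := fun h0 => by
      obtain ⟨j, hj, hj0⟩ := Finset.lcm_eq_zero_iff.mp h0
      exact hs j hj hj0
    refine (pow_dvd_or_pow_dvd_of_pow_dvd_lcm hg hi hs0 h).elim
      (fun h => ⟨i, Finset.mem_insert_self i s, h⟩) fun h => ?_
    obtain ⟨j, hj, hgj⟩ := ih hs h
    exact ⟨j, Finset.mem_insert_of_mem hj, hgj⟩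

end Lcm

section CramersRule

open Module
open scoped Matrix

theorem exists_basis_mem_or_mem_range {K V ι : Type*} [Field K] [AddCommGroup V] [Module K V]
    (b₀ : Basis ι K V) (G : Set V) :
    ∃ b : Basis ι K V, (∀ i, b i ∈ G ∨ b i ∈ Set.range b₀) ∧
      Submodule.span K (b '' {i | b i ∈ G}) = Submodule.span K G := by
  obtain ⟨s, hsG, hsSpan, hs⟩ := exists_linearIndependent K G
  have hst : s ⊆ G ∪ Set.range b₀ := hsG.trans Set.subset_union_left
  have ht : ⊤ ≤ Submodule.span K (G ∪ Set.range b₀) :=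
    b₀.span_eq.ge.trans (Submodule.span_mono Set.subset_union_right)
  let b := Basis.extendLe hs hst ht
  refine ⟨b.reindex (b.indexEquiv b₀), fun i => ?_, le_antisymm ?_ ?_⟩
  · rw [Basis.reindex_apply]
    exact Basis.extendLe_subset hs hst ht ⟨_, rfl⟩
  · exact Submodule.span_mono (Set.image_subset_iff.mpr fun i hi => hi)
  · rw [← hsSpan]
    refine Submodule.span_mono fun v hv => ?_
    obtain ⟨i, rfl⟩ := Basis.subset_extendLe hs hst ht hv
    exact ⟨b.indexEquiv b₀ i, by simpa using hsG hv, by simp [b]⟩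

theorem map_mem_span_image_of_smul_mem {A K V W : Type*} [CommRing A] [Field K] [Algebra A K]
    [FaithfulSMul A K] [AddCommGroup V] [Module A V] [AddCommGroup W] [Module A W] [Module K W]
    [IsScalarTower A K W] (φ : V →ₗ[A] W) {G : Set V} {v : V} {h : A} (hh : h ≠ 0)
    (hv : h • v ∈ Submodule.span A G) : φ v ∈ Submodule.span K (φ '' G) := by
  have hmem : φ (h • v) ∈ Submodule.span K (φ '' G) :=
    Submodule.span_le_restrictScalars A K _
      (Submodule.map_span φ G ▸ Submodule.mem_map_of_mem hv)
  rw [map_smul, ← algebraMap_smul K] at hmem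
  exact (Submodule.smul_mem_iff _ (by simpa using hh)).mp hmem

variable {A ι : Type*} [CommRing A] [Fintype ι] [DecidableEq ι]

theorem det_smul_eq_sum_vecMul_adjugate (M : Matrix ι ι A) (v : ι → A) :
    M.det • v = ∑ i, (v ᵥ* M.adjugate) i • M i := by
  rw [← Matrix.vecMul_eq_sum, Matrix.vecMul_vecMul, Matrix.adjugate_mul, Matrix.vecMul_smul,
    Matrix.vecMul_one]

/-- The rows of `M` are a maximal subset of `G` that is independent over the fraction field,
completed by unit vectors. Cramer's rule expands `M.det • v` in the rows of `M`, and the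
coefficients of the rows outside `G` vanish because `v` lies in the span of `G` over that field. -/
theorem exists_matrix_det_smul_mem_span [IsDomain A] (G : Set (ι → A)) :
    ∃ M : Matrix ι ι A, M.det ≠ 0 ∧ (∀ i, M i ∈ G ∨ ∃ j, M i = Pi.single j 1) ∧
      ∀ (v : ι → A) (h : A), h ≠ 0 → h • v ∈ Submodule.span A G →
        M.det • v ∈ Submodule.span A G := by
  let K := FractionRing A
  let φ : (ι → A) →ₗ[A] (ι → K) := (Algebra.linearMap A K).compLeft ι
  have hφ : Function.Injective φ := (FaithfulSMul.algebraMap_injective A K).comp_left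
  have hφ_single (j : ι) : φ (Pi.single j 1) = Pi.basisFun K ι j := by
    ext i
    simp [φ, Pi.single_apply, apply_ite (algebraMap A K)]
  obtain ⟨b, hb, hbSpan⟩ := exists_basis_mem_or_mem_range (Pi.basisFun K ι) (φ '' G)
  have hlift (i : ι) : ∃ m : ι → A, (m ∈ G ∨ ∃ j, m = Pi.single j 1) ∧ φ m = b i := by
    rcases hb i with ⟨m, hm, hmi⟩ | ⟨j, hj⟩
    · exact ⟨m, .inl hm, hmi⟩
    · exact ⟨_, .inr ⟨j, rfl⟩, (hφ_single j).trans hj⟩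
  choose M hM hMb using hlift
  refine ⟨Matrix.of M, fun h0 => ?_, hM, fun v h hh hv => ?_⟩
  · have hdet : algebraMap A K (Matrix.of M).det = (Pi.basisFun K ι).det b := by
      rw [RingHom.map_det, Pi.basisFun_det, ← funext hMb]
      rfl
    exact ((Pi.basisFun K ι).isUnit_det b).ne_zero (by rw [← hdet, h0, map_zero])
  rw [det_smul_eq_sum_vecMul_adjugate]
  set u := v ᵥ* (Matrix.of M).adjugate
  have hφsum : (Matrix.of M).det • φ v = ∑ i, algebraMap A K (u i) • b i := by
    simp only [← map_smul, det_smul_eq_sum_vecMul_adjugate, map_sum, algebraMap_smul, ← hMb, u]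
    rfl
  have hu (i : ι) (hi : M i ∉ G) : u i = 0 := by
    have hmem : (Matrix.of M).det • φ v ∈ Submodule.span K (b '' {i | b i ∈ φ '' G}) :=
      hbSpan ▸ Submodule.smul_of_tower_mem _ _ (map_mem_span_image_of_smul_mem φ hh hv)
    have hbi : b i ∉ φ '' G := by rwa [← hMb, hφ.mem_set_image]
    rw [b.mem_span_image, hφsum] at hmem
    have hzero := Finsupp.notMem_support_iff.mp fun hmem_i => hbi (hmem hmem_i)
    rwa [b.repr_sum_self, FaithfulSMul.algebraMap_eq_zero_iff] at hzero
  refine Submodule.sum_mem _ fun i _ => ?_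
  by_cases hi : M i ∈ G
  · exact Submodule.smul_mem _ _ (Submodule.subset_span hi)
  · rw [hu i hi, zero_smul]
    exact zero_mem _

end CramersRule

section Truncation

open MvPolynomial

/-- The exponents of weight `d` of the monomials that are divisible by no `X i ^ q`. They index
the generators of the weight `d` part of a quotient in which every `X i ^ q` vanishes. -/
def reducedExponents {σ M : Type*} [AddCommMonoid M] (w : σ → M) (q : ℕ) (d : M) :
    Set (σ →₀ ℕ) :=
  {m | (∀ i, m i < q) ∧ Finsupp.weight w m = d}

/-- The family of the coefficients of a polynomial at the exponents in `s`, which turns ideals into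
submodules of a free module. -/
noncomputable def coeffsOn {σ : Type*} (A : Type*) [CommSemiring A] (s : Set (σ →₀ ℕ)) :
    MvPolynomial σ A →ₗ[A] (s → A) :=
  LinearMap.pi fun m => lcoeff A m

section

variable {σ A : Type*} [CommSemiring A]

theorem coeffsOn_apply (s : Set (σ →₀ ℕ)) (f : MvPolynomial σ A) (m : s) :
    coeffsOn A s f m = coeff m f :=
  rfl

theorem mem_of_forall_coeff_eq_zero {L : Ideal (MvPolynomial σ A)} {q : ℕ}
    (hX : ∀ i, X i ^ q ∈ L) {f : MvPolynomial σ A}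
    (hf : ∀ m : σ →₀ ℕ, (∀ i, m i < q) → coeff m f = 0) : f ∈ L := by
  rw [f.as_sum]
  refine sum_mem fun m hm => ?_
  obtain ⟨i, hi⟩ : ∃ i, q ≤ m i := by
    by_contra! hlt
    exact mem_support_iff.mp hm (hf m hlt)
  refine L.mem_of_dvd ?_ (hX i)
  rw [X_pow_eq_monomial, monomial_dvd_monomial]
  exact ⟨.inr (Finsupp.single_le_iff.mpr hi), one_dvd _⟩

open scoped Pointwise in
theorem map_coeffsOn_span (S : Set (MvPolynomial σ A)) (s : Set (σ →₀ ℕ)) :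
    ((Ideal.span S).restrictScalars A).map (coeffsOn A s) =
      Submodule.span A
        (coeffsOn A s '' (Set.range (fun m : σ →₀ ℕ => monomial m (1 : A)) • S)) := by
  have htop : Submodule.span A (Set.range fun m : σ →₀ ℕ => monomial m (1 : A)) = ⊤ :=
    coe_basisMonomials σ A ▸ (basisMonomials σ A).span_eq
  rw [← Submodule.map_span, Submodule.span_smul_of_span_eq_top htop]

end

variable {σ M A : Type*} [CommRing A] [AddCommMonoid M] {w : σ → M}

attribute [local instance] MvPolynomial.weightedGradedAlgebra in
theorem mem_of_forall_coeffsOn_mem_map [DecidableEq M] {L : Ideal (MvPolynomial σ A)}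
    (hL : L.IsHomogeneous (weightedHomogeneousSubmodule A w)) {q : ℕ} (hX : ∀ i, X i ^ q ∈ L)
    {f : MvPolynomial σ A}
    (hf : ∀ d, coeffsOn A (reducedExponents w q d) f ∈
      (L.restrictScalars A).map (coeffsOn A (reducedExponents w q d))) : f ∈ L := by
  rw [mem_iff_weightedHomogeneousComponent_mem A w hL]
  intro d
  obtain ⟨l, hl, hlf⟩ := hf d
  have hsub : weightedHomogeneousComponent w d (f - l) ∈ L := by
    refine mem_of_forall_coeff_eq_zero hX fun m hm => ?_
    rw [coeff_weightedHomogeneousComponent]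
    split_ifs with hmd
    · have hfl : coeff m l = coeff m f := congrFun hlf ⟨m, hm, hmd⟩
      rw [coeff_sub, hfl, sub_self]
    · rfl
  rw [map_sub] at hsub
  exact (Submodule.sub_mem_iff_left _ (weightedHomogeneousComponent_mem_of_mem A w hL hl d)).mp hsub

theorem finite_setOf_forall_lt (σ : Type*) [Finite σ] (q : ℕ) :
    {m : σ →₀ ℕ | ∀ i, m i < q}.Finite := by
  refine Set.Finite.of_finite_image (f := fun m i => m i) ?_ DFunLike.coe_injective.injOn
  refine (Set.Finite.pi fun _ => Set.finite_lt_nat q).subset ?_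
  rintro _ ⟨m, hm, rfl⟩ i -
  exact hm i

theorem finite_reducedExponents [Finite σ] (w : σ → M) (q : ℕ) (d : M) :
    (reducedExponents w q d).Finite :=
  (finite_setOf_forall_lt σ q).subset fun _ hm => hm.1

theorem finite_setOf_reducedExponents_nonempty [Finite σ] (w : σ → M) (q : ℕ) :
    {d | (reducedExponents w q d).Nonempty}.Finite :=
  ((finite_setOf_forall_lt σ q).image (Finsupp.weight w)).subset
    fun _ ⟨m, hm, hmd⟩ => ⟨m, hm, hmd⟩

theorem ncard_reducedExponents_le {M : Type*} [AddCancelCommMonoid M] [IsAddTorsionFree M]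
    {w : Fin 2 → M} (hw : w ≠ 0) (q : ℕ) (d : M) : (reducedExponents w q d).ncard ≤ q := by
  obtain ⟨i, hi⟩ := Function.ne_iff.mp hw
  have hcover : ∀ i j : Fin 2, j = i ∨ j = i.rev := by decide
  have hweight (m : Fin 2 →₀ ℕ) : Finsupp.weight w m = m i • w i + m i.rev • w i.rev := by
    rw [Finsupp.weight_apply, Finsupp.sum_fintype _ _ (by simp), Fin.sum_univ_two]
    fin_cases i
    · rfl
    · exact add_comm _ _
  have hinj : Function.Injective fun n : ℕ => n • w i :=
    injective_nsmul_iff_not_isOfFinAddOrder.mpr (not_isOfFinAddOrder_of_isAddTorsionFree hi)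
  have hcoord : Set.InjOn (fun m : Fin 2 →₀ ℕ => m i.rev) (reducedExponents w q d) := by
    intro m hm l hl (hml : m i.rev = l i.rev)
    have hsum := hm.2.trans hl.2.symm
    rw [hweight, hweight, hml] at hsum
    have hmli : m i = l i := hinj (add_right_cancel hsum)
    ext j
    rcases hcover i j with rfl | rfl
    exacts [hmli, hml]
  simpa using Set.ncard_le_ncard_of_injOn (t := Set.Iio q) _ (fun m hm => hm.1 i.rev) hcoord

open Polynomial in
theorem natDegree_det_le {R ι : Type*} [CommRing R] [Fintype ι] [DecidableEq ι]
    (M : Matrix ι ι R[X]) (D : ℕ) (hM : ∀ i j, (M i j).natDegree ≤ D) :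
    M.det.natDegree ≤ Fintype.card ι * D := by
  rw [Matrix.det_apply]
  refine natDegree_sum_le_of_forall_le _ _ fun σ _ => ?_
  rw [Units.smul_def, zsmul_eq_mul, ← C_eq_intCast]
  refine (natDegree_C_mul_le _ _).trans ((natDegree_prod_le _ _).trans ?_)
  exact (Finset.sum_le_card_nsmul _ _ D fun i _ => hM _ _).trans (by simp)

open Polynomial in
theorem exists_natDegree_le_smul_mem_span {R ι : Type*} [CommRing R] [IsDomain R] [Finite ι]
    (G : Set (ι → R[X])) (D : ℕ) (hG : ∀ v ∈ G, ∀ i, (v i).natDegree ≤ D) :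
    ∃ δ : R[X], δ ≠ 0 ∧ δ.natDegree ≤ Nat.card ι * D ∧
      ∀ (v : ι → R[X]) (h : R[X]), h ≠ 0 → h • v ∈ Submodule.span R[X] G →
        δ • v ∈ Submodule.span R[X] G := by
  classical
  have := Fintype.ofFinite ι
  obtain ⟨M, hM0, hM, hspan⟩ := exists_matrix_det_smul_mem_span G
  refine ⟨M.det, hM0, ?_, hspan⟩
  rw [Nat.card_eq_fintype_card]
  refine natDegree_det_le M D fun i j => ?_
  rcases hM i with hi | ⟨l, hl⟩
  · exact hG _ hi j
  · rw [hl, Pi.single_apply]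
    split_ifs <;> simp

open scoped Polynomial Pointwise

variable {k : Type*} [Field k]

theorem exists_natDegree_le_smul_mem_map_coeffsOn {S : Set (MvPolynomial σ k[X])} {D : ℕ}
    (hS : ∀ f ∈ S, ∀ m, (coeff m f).natDegree ≤ D) {s : Set (σ →₀ ℕ)} (hs : s.Finite) :
    ∃ δ : k[X], δ ≠ 0 ∧ δ.natDegree ≤ s.ncard * D ∧
      ∀ (f : MvPolynomial σ k[X]) (h : k[X]), h ≠ 0 → h • f ∈ Ideal.span S →
        coeffsOn k[X] s (δ • f) ∈
          ((Ideal.span S).restrictScalars k[X]).map (coeffsOn k[X] s) := by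
  have := hs.to_subtype
  let G := coeffsOn k[X] s '' (Set.range (fun m : σ →₀ ℕ => monomial m (1 : k[X])) • S)
  have hG : ∀ v ∈ G, ∀ m, (v m).natDegree ≤ D := by
    rintro _ ⟨_, ⟨_, ⟨l, rfl⟩, f, hf, rfl⟩, rfl⟩ m
    simp only [coeffsOn_apply, coeff_monomial_mul']
    split_ifs
    · simpa using hS f hf _
    · simp
  obtain ⟨δ, hδ, hδD, hspan⟩ := exists_natDegree_le_smul_mem_span G D hG
  refine ⟨δ, hδ, hδD, fun f h hh hf => ?_⟩
  rw [map_coeffsOn_span, map_smul]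
  refine hspan _ h hh ?_
  rw [← map_smul, ← map_coeffsOn_span]
  exact Submodule.mem_map_of_mem hf

attribute [local instance] MvPolynomial.weightedGradedAlgebra in
theorem exists_prime_pow_bound_smul_mem [Finite σ] [DecidableEq M] {S : Set (MvPolynomial σ k[X])}
    (hL : (Ideal.span S).IsHomogeneous (weightedHomogeneousSubmodule k[X] w)) {q N D : ℕ}
    (hX : ∀ i, X i ^ q ∈ Ideal.span S) (hS : ∀ f ∈ S, ∀ m, (coeff m f).natDegree ≤ D)
    (hN : ∀ d, (reducedExponents w q d).ncard ≤ N) :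
    ∃ δ : k[X], δ ≠ 0 ∧ (∀ π n, Prime π → π ^ n ∣ δ → n ≤ N * D) ∧
      ∀ (f : MvPolynomial σ k[X]) (h : k[X]), h ≠ 0 → h • f ∈ Ideal.span S →
        δ • f ∈ Ideal.span S := by
  classical
  let _ : NormalizedGCDMonoid k[X] := UniqueFactorizationMonoid.toNormalizedGCDMonoid k[X]
  choose δ hδ hδD hδS using fun d =>
    exists_natDegree_le_smul_mem_map_coeffsOn hS (finite_reducedExponents w q d)
  let s := (finite_setOf_reducedExponents_nonempty w q).toFinset
  refine ⟨s.lcm δ, ?_, fun π n hπ hdvd => ?_, fun f h hh hf => ?_⟩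
  · rw [Ne, Finset.lcm_eq_zero_iff]
    rintro ⟨d, -, hd⟩
    exact hδ d hd
  · rcases eq_or_ne n 0 with rfl | hn
    · exact Nat.zero_le _
    obtain ⟨d, -, hd⟩ := exists_pow_dvd_of_pow_dvd_finset_lcm hπ hn (fun d _ => hδ d) hdvd
    calc n ≤ n * π.natDegree := Nat.le_mul_of_pos_right n hπ.irreducible.natDegree_pos
      _ = (π ^ n).natDegree := (Polynomial.natDegree_pow π n).symm
      _ ≤ (δ d).natDegree := Polynomial.natDegree_le_of_dvd hd (hδ d)
      _ ≤ (reducedExponents w q d).ncard * D := hδD d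
      _ ≤ N * D := Nat.mul_le_mul_right D (hN d)
  · refine mem_of_forall_coeffsOn_mem_map hL hX fun d => ?_
    rcases (reducedExponents w q d).eq_empty_or_nonempty with hd | hd
    · have := Set.isEmpty_coe_sort.mpr hd
      rw [Subsingleton.elim (coeffsOn k[X] _ _) 0]
      exact zero_mem _
    · obtain ⟨c, hc⟩ := Finset.dvd_lcm (f := δ) ((Set.Finite.mem_toFinset _).mpr hd : d ∈ s)
      rw [hc, mul_comm, mul_smul, map_smul]
      exact Submodule.smul_mem _ c (hδS d f h hh hf)

end Truncation

section LinearGrowth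

open MvPolynomial

theorem surjective_algebraMap_quotient_span_X {A R σ : Type*} [CommRing A] [CommRing R]
    [Algebra A R] {φ : MvPolynomial σ A →ₐ[A] R} (hφ : Function.Surjective φ) :
    Function.Surjective
      (algebraMap A (R ⧸ Ideal.span (Set.range fun i => φ (X i)))) := by
  let I := Ideal.span (Set.range fun i => φ (X i))
  have hfac : (Ideal.Quotient.mkₐ A I).comp φ =
      (Algebra.ofId A (R ⧸ I)).comp (aeval (0 : σ → A)) := by
    ext i
    have hi : φ (X i) ∈ I := Ideal.subset_span ⟨i, rfl⟩
    simpa using Ideal.Quotient.eq_zero_iff_mem.mpr hi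
  have hsurj : Function.Surjective ((Algebra.ofId A (R ⧸ I)).comp (aeval (0 : σ → A))) :=
    hfac ▸ (Ideal.Quotient.mkₐ_surjective A I).comp hφ
  exact Function.Surjective.of_comp hsurj

theorem comap_frobeniusPower_span_X {A R σ : Type*} [CommRing A] [CommRing R] [Algebra A R]
    {φ : MvPolynomial σ A →ₐ[A] R} (hφ : Function.Surjective φ) (p : ℕ) [ExpChar R p] (e : ℕ)
    {T : Set (MvPolynomial σ A)} (hT : Ideal.span T = RingHom.ker φ) :
    (frobeniusPower (Ideal.span (Set.range fun i => φ (X i))) (p ^ e)).comap φ =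
      Ideal.span (T ∪ Set.range fun i => X i ^ p ^ e) := by
  have hmap : frobeniusPower (Ideal.span (Set.range fun i => φ (X i))) (p ^ e) =
      (Ideal.span (Set.range fun i => X i ^ p ^ e)).map φ := by
    rw [frobeniusPower_span, Ideal.map_span, ← Set.range_comp, ← Set.range_comp]
    simp only [Function.comp_def, map_pow]
  rw [hmap, Ideal.span_union, hT, sup_comm]
  exact Ideal.comap_map_of_surjective' φ hφ _

theorem exists_natDegree_coeff_le {R σ : Type*} [CommSemiring R]
    {T : Set (MvPolynomial σ (Polynomial R))} (hT : T.Finite) :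
    ∃ D : ℕ, ∀ f ∈ T, ∀ m, (coeff m f).natDegree ≤ D := by
  refine ⟨hT.toFinset.sup fun f => f.support.sup fun m => (coeff m f).natDegree, fun f hf m => ?_⟩
  by_cases hm : m ∈ f.support
  · exact (Finset.le_sup (f := fun m => (coeff m f).natDegree) hm).trans
      (Finset.le_sup (f := fun f => f.support.sup fun m => (coeff m f).natDegree)
        (hT.mem_toFinset.mpr hf))
  · simp [notMem_support_iff.mp hm]

open scoped Polynomial

variable {k σ M : Type*} [Field k] [Finite σ] [AddCommMonoid M] [DecidableEq M] {w : σ → M}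

attribute [local instance] MvPolynomial.weightedGradedAlgebra in
theorem hasLinearGrowthOfPrimaryDecompositions_of_surjective {R : Type*} [CommRing R]
    [Algebra k[X] R] (p : ℕ) [ExpChar R p] {N : ℕ}
    (hN : ∀ q d, (reducedExponents w q d).ncard ≤ q * N) {φ : MvPolynomial σ k[X] →ₐ[k[X]] R}
    (hφ : Function.Surjective φ)
    (hker : (RingHom.ker φ).IsHomogeneous (weightedHomogeneousSubmodule k[X] w)) :
    HasLinearGrowthOfPrimaryDecompositions p (Ideal.span (Set.range fun i => φ (X i))) := by
  classical
  have : IsNoetherianRing R := isNoetherianRing_of_surjective _ R φ.toRingHom hφ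
  obtain ⟨T, hT⟩ : ∃ T : Finset (MvPolynomial σ k[X]), Ideal.span T = RingHom.ker φ :=
    IsNoetherian.noetherian _
  obtain ⟨D, hD⟩ := exists_natDegree_coeff_le T.finite_toSet
  refine hasLinearGrowthOfPrimaryDecompositions_of_torsion p
    (surjective_algebraMap_quotient_span_X hφ) (N * D) fun e => ?_
  set J := frobeniusPower (Ideal.span (Set.range fun i => φ (X i))) (p ^ e)
  let S : Set (MvPolynomial σ k[X]) := T ∪ Set.range fun i => X i ^ p ^ e
  have hS : J.comap φ = Ideal.span S := comap_frobeniusPower_span_X hφ p e hT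
  have hX (i : σ) : X i ^ p ^ e ∈ Ideal.span S := Ideal.subset_span (.inr ⟨i, rfl⟩)
  have hSD : ∀ f ∈ S, ∀ m, (coeff m f).natDegree ≤ D := by
    rintro f (hf | ⟨i, rfl⟩) m
    · exact hD f hf m
    · simp only [X_pow_eq_monomial, coeff_monomial]
      split_ifs <;> simp
  have hShom : (Ideal.span S).IsHomogeneous (weightedHomogeneousSubmodule k[X] w) := by
    rw [Ideal.span_union, hT]
    refine hker.sup (Ideal.homogeneous_span _ _ ?_)
    rintro _ ⟨i, rfl⟩
    exact ⟨_, (isWeightedHomogeneous_X k[X] w i).pow (p ^ e)⟩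
  obtain ⟨δ, hδ, hδN, hδS⟩ := exists_prime_pow_bound_smul_mem hShom hX hSD (hN (p ^ e))
  refine ⟨δ, hδ, fun π n hπ hdvd => mul_assoc (p ^ e) N D ▸ hδN π n hπ hdvd, fun z hz => ?_⟩
  obtain ⟨f, rfl⟩ := hφ z
  obtain ⟨h, hh, hf⟩ := mem_torsionClosure.mp hz
  rw [← map_smul, ← Ideal.mem_comap, hS] at hf ⊢
  exact hδS f h (nonZeroDivisors.ne_zero hh) hf

end LinearGrowth

section FinSucc

open MvPolynomial

/-- The isomorphism `k[x₀, …, xₙ] ≃ k[x₀][x₁, …, xₙ]`, the variables on the right being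
indexed from `0`. -/
noncomputable def polynomialEquiv (k : Type*) [CommSemiring k] (n : ℕ) :
    MvPolynomial (Fin (n + 1)) k ≃ₐ[k] MvPolynomial (Fin n) (Polynomial k) :=
  (renameEquiv k (_root_.finSuccEquiv n)).trans (optionEquivRight k (Fin n))

section

variable {k : Type*} [CommSemiring k] {n : ℕ}

theorem polynomialEquiv_X_zero : polynomialEquiv k n (X 0) = C Polynomial.X := by
  simp [polynomialEquiv]

theorem polynomialEquiv_X_succ (i : Fin n) : polynomialEquiv k n (X i.succ) = X i := by
  simp [polynomialEquiv]

theorem isWeightedHomogeneous_polynomialEquiv {M : Type*} [AddCommMonoid M] {w : Fin n → M}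
    {f : MvPolynomial (Fin (n + 1)) k} {d : M}
    (hf : IsWeightedHomogeneous (Fin.cons 0 w : Fin (n + 1) → M) f d) :
    IsWeightedHomogeneous w (polynomialEquiv k n f) d := by
  rw [f.as_sum, map_sum]
  refine sum_mem (S := weightedHomogeneousSubmodule (Polynomial k) w d) fun m hm => ?_
  have hd : 0 + ∑ i : Fin n, m i.succ • w i = d := by
    simpa [Finsupp.weight_apply, Finsupp.sum_fintype, Fin.sum_univ_succ] using
      hf (mem_support_iff.mp hm)
  have hmonomial : polynomialEquiv k n (monomial m (coeff m f)) =
      C (Polynomial.C (coeff m f) * Polynomial.X ^ m 0) * ∏ i : Fin n, X i ^ m i.succ := by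
    rw [monomial_eq, Finsupp.prod_fintype _ _ (by simp), Fin.prod_univ_succ, ← algebraMap_eq,
      map_mul, AlgEquiv.commutes, IsScalarTower.algebraMap_apply k (Polynomial k)]
    simp [polynomialEquiv_X_zero, polynomialEquiv_X_succ, mul_assoc]
  rw [hmonomial, ← hd]
  exact (isWeightedHomogeneous_C w _).mul
    (IsWeightedHomogeneous.prod _ _ _ fun i _ => (isWeightedHomogeneous_X _ w i).pow _)

end

open scoped Polynomial

attribute [local instance] MvPolynomial.weightedGradedAlgebra in
theorem hasLinearGrowthOfPrimaryDecompositions_quotient {k M : Type*} [Field k] [AddCommMonoid M]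
    (p : ℕ) [ExpChar k p] {n N : ℕ} {w : Fin n → M}
    (hN : ∀ q d, (reducedExponents w q d).ncard ≤ q * N) {S : Set (MvPolynomial (Fin (n + 1)) k)}
    (hS : ∀ f ∈ S, ∃ d, IsWeightedHomogeneous (Fin.cons 0 w : Fin (n + 1) → M) f d) :
    HasLinearGrowthOfPrimaryDecompositions p
      (Ideal.span (Set.range fun i : Fin n => Ideal.Quotient.mk (Ideal.span S) (X i.succ))) := by
  classical
  let R := MvPolynomial (Fin (n + 1)) k ⧸ Ideal.span S
  rcases subsingleton_or_nontrivial R with hR | hR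
  · exact ⟨0, fun e => ⟨∅, Subsingleton.elim _ _, by simp⟩⟩
  have : ExpChar R p := expChar_of_injective_algebraMap (algebraMap k R).injective p
  let ψ : MvPolynomial (Fin n) k[X] →+* R :=
    (Ideal.Quotient.mk (Ideal.span S)).comp (polynomialEquiv k n).symm
  let _ : Algebra k[X] R := (ψ.comp C).toAlgebra
  let φ : MvPolynomial (Fin n) k[X] →ₐ[k[X]] R := { ψ with commutes' := fun _ => rfl }
  have hφ : Function.Surjective φ :=
    Ideal.Quotient.mk_surjective.comp (polynomialEquiv k n).symm.surjective
  have hker : RingHom.ker φ = Ideal.span (polynomialEquiv k n '' S) := by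
    let θ := (polynomialEquiv k n).toRingEquiv
    calc RingHom.ker φ = (RingHom.ker (Ideal.Quotient.mk (Ideal.span S))).comap θ.symm := rfl
      _ = (Ideal.span S).comap θ.symm := by rw [Ideal.mk_ker]
      _ = (Ideal.span S).map θ := Ideal.comap_symm θ
      _ = Ideal.span (polynomialEquiv k n '' S) := Ideal.map_span _ _
  have hX (i : Fin n) : φ (X i) = Ideal.Quotient.mk (Ideal.span S) (X i.succ) :=
    congrArg (Ideal.Quotient.mk _)
      ((polynomialEquiv k n).symm_apply_eq.mpr (polynomialEquiv_X_succ i).symm)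
  simp only [← hX]
  refine hasLinearGrowthOfPrimaryDecompositions_of_surjective p hN hφ ?_
  rw [hker]
  refine Ideal.homogeneous_span _ _ ?_
  rintro _ ⟨f, hf, rfl⟩
  exact (hS f hf).imp fun d hd => isWeightedHomogeneous_polynomialEquiv hd

end FinSucc

theorem mainTheorem3_general {k M : Type*} [Field k] (p : ℕ) [ExpChar k p]
    [AddCancelCommMonoid M] [IsAddTorsionFree M] {a b : M} (hab : a ≠ 0 ∨ b ≠ 0) {ι : Type*}
    (f : ι → MvPolynomial (Fin 3) k)
    (hf : ∀ i, ∃ d, MvPolynomial.IsWeightedHomogeneous ![0, a, b] (f i) d) :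
    HasLinearGrowthOfPrimaryDecompositions p
      (Ideal.span {Ideal.Quotient.mk (Ideal.span (Set.range f)) (MvPolynomial.X 1),
        Ideal.Quotient.mk (Ideal.span (Set.range f)) (MvPolynomial.X 2)}) := by
  have hw : ![a, b] ≠ 0 := by
    simpa [imp_iff_not_or] using hab
  have hN (q : ℕ) (d : M) : (reducedExponents ![a, b] q d).ncard ≤ q * 1 :=
    (ncard_reducedExponents_le hw q d).trans (mul_one q).ge
  have h := hasLinearGrowthOfPrimaryDecompositions_quotient p hN (Set.forall_mem_range.mpr hf)
  have hrange : Set.range (fun i : Fin 2 => Ideal.Quotient.mk (Ideal.span (Set.range f))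
      (MvPolynomial.X i.succ)) = {Ideal.Quotient.mk (Ideal.span (Set.range f)) (MvPolynomial.X 1),
        Ideal.Quotient.mk (Ideal.span (Set.range f)) (MvPolynomial.X 2)} := by
    ext
    simp [Fin.exists_fin_two, eq_comm]
  rwa [hrange] at h

/-- The variables `t, x, y` are `X 0, X 1, X 2`, of degrees `0, 1, 1`. -/
theorem mainTheorem3 {k : Type*} [Field k] (p : ℕ) [Fact p.Prime] [CharP k p]
    (r : ℕ) (f : Fin r → MvPolynomial (Fin 3) k)
    (hf : ∀ i, ∃ d : ℕ, MvPolynomial.IsWeightedHomogeneous (![0, 1, 1] : Fin 3 → ℕ) (f i) d) :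
    HasLinearGrowthOfPrimaryDecompositions p
      (Ideal.span {Ideal.Quotient.mk (Ideal.span (Set.range f)) (MvPolynomial.X 1),
        Ideal.Quotient.mk (Ideal.span (Set.range f)) (MvPolynomial.X 2)}) :=
  have : ExpChar k p := ExpChar.prime Fact.out
  mainTheorem3_general p (.inl one_ne_zero) f hf
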